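/- Graphs are finite and may contain parallel edges but no loops. A nowhere-zero $3$-flow of a graph $G$ is an orientation of $G$ together with a map $f\colon E(G)\to\mathbb{Z}$ such that $1\le |f(e)|\le 2$ for every edge $e$ and such that, at every vertex, the sum of $f$ over the outgoing arcs equals the sum of $f$ over the incoming arcs. For an edge $e$, $G/e$ denotes the graph obtained from $G$ by identifying the two ends of $e$ and deleting the resulting loops. A bridgeless graph $G$ is called $3$-flow-critical if $G$ admits no nowhere-zero $3$-flow but $G/e$ admits a nowhere-zero $3$-flow for every edge $e\in E(G)$. Theorem. For any positive integer $N$ and any rational number $r$ with $\frac{7}{4}<r<3$, there exists a connected $3$-flow-critical graph $G$ on $n\ge N$ vertices with $$rn-\frac{5}{8}\le |E(G)|\le rn+\frac{5}{8}.$$ -/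

import Mathlib

open scoped Graph

namespace Graph

/-- Two vertices of a multigraph are joined by a walk. -/
def Joined {α β : Type*} (G : Graph α β) (x y : α) : Prop :=
  Relation.ReflTransGen G.Adj x y

/-- A multigraph is connected if it has a vertex and any two of its vertices are joined by a
walk. -/
def IsConnected {α β : Type*} (G : Graph α β) : Prop :=
  V(G).Nonempty ∧ ∀ x ∈ V(G), ∀ y ∈ V(G), G.Joined x y

/-- An edge is a bridge if its deletion separates its two ends. -/
def IsBridge {α β : Type*} (G : Graph α β) (e : β) : Prop :=
  ∃ x y, G.IsLink e x y ∧ ¬ (G.deleteEdges {e}).Joined x y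

/-- A multigraph is bridgeless if none of its edges is a bridge. -/
def IsBridgeless {α β : Type*} (G : Graph α β) : Prop :=
  ∀ e, ¬ G.IsBridge e

/-- An orientation of a multigraph: each edge `e` becomes an arc from `tail e` to `head e`,
where `tail e` and `head e` are the two ends of `e`. -/
structure Orientation {α β : Type*} (G : Graph α β) where
  tail : E(G) → α
  head : E(G) → α
  isLink : ∀ e : E(G), G.IsLink e (tail e) (head e)

/-- `(D, f)` is an integer flow: at every vertex the total of `f` over the outgoing arcs minus
the total over the incoming arcs is zero (for multigraphs with finitely many edges). -/
def IsIntegerFlow {α β : Type*} (G : Graph α β) (D : G.Orientation) (f : E(G) → ℤ) : Prop :=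
  ∀ v ∈ V(G),
    (∑ᶠ (e : E(G)) (_ : D.tail e = v), f e) - (∑ᶠ (e : E(G)) (_ : D.head e = v), f e) = 0

/-- `G` admits a nowhere-zero `k`-flow. -/
def HasNowhereZeroFlow {α β : Type*} (G : Graph α β) (k : ℕ) : Prop :=
  ∃ (D : G.Orientation) (f : E(G) → ℤ),
    G.IsIntegerFlow D f ∧ ∀ e : E(G), 1 ≤ |f e| ∧ |f e| ≤ (k : ℤ) - 1

/-- The contraction `G / e` of an edge of a loopless multigraph: the two ends of `e` are
identified, and the resulting loops are deleted. The vertices of `G / e` are the classes of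
identified vertices, that is, the set of the two ends of `e` and the singletons of the other
vertices. -/
def contractEdge {α β : Type*} (G : Graph α β) (e : β) : Graph (Set α) β :=
  let G' : Graph (Set α) β := G.map fun w ↦ {x | x = w ∨ G.IsLink e w x}
  G'.deleteEdges {f | ∃ x, G'.IsLoopAt f x}

/-- A bridgeless multigraph is `3`-flow-critical if it has no nowhere-zero `3`-flow, while every
contraction of one of its edges has one. -/
structure IsThreeFlowCritical {α β : Type*} (G : Graph α β) : Prop where
  bridgeless : G.IsBridgeless
  no_flow : ¬ G.HasNowhereZeroFlow 3
  contract_flow : ∀ e ∈ E(G), (G.contractEdge e).HasNowhereZeroFlow 3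

end Graph

/-!
If `G` has no nowhere-zero `3`-flow, then a nowhere-zero `3`-flow of `G / e` lifts to one of `G - e`:
if its lift did not balance at the ends of `e`, then `e` could carry the difference modulo `3`. So
criticality may be tested by deleting edges instead of contracting them, and the multigraphs below
are built with the deletion property `FlowNet.Net.IsCritical`: no nowhere-zero flow modulo `3`, but
an integer nowhere-zero `3`-flow after the deletion of any edge. Only the implications from modulo
`3` non-existence to integer non-existence, and from deletion to contraction, are needed
(`FlowNet.Net.IsCritical.isThreeFlowCritical`).

Flow conservation is expressed in dual form, as orthogonality to all coboundaries of potentials.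
This makes the behaviour of flows under gluing a matter of pulling potentials back.

Identifying an edge of one critical graph with an edge of another gives a critical graph
(`FlowNet.Net.IsCritical.glue`). Hence the pairs `(n - 2, m - 1)`, where `n` and `m` are the numbers
of vertices and edges of a critical graph, are closed under addition. Three kinds of blocks are
combined.

* The complete graph on four vertices contributes `(2, 5)`.
* The complete bipartite graph with parts of sizes `3` and `2 s + 3`, together with an edge inside
  the part of size `3`, contributes `(2 s + 4, 6 s + 9)`, of slope tending to `3`.
* A chain of six-terminal units, each with four vertices and seven edges, closed at both ends,
  contributes `(4 k + 11, 7 k + 23)`, of slope tending to `7 / 4`. Modulo `3`, the first two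
  terminals of such a chain always carry equal values, which the closing triangle forbids. After the
  deletion of an edge, other boundary values become available, and they can be propagated to the
  end of the chain. Finite lists of boundary values with these properties
  (`FlowNet.Pole.Good`, `FlowNet.Advances`) carry the induction on the length of the chain.

Mixing dense and sparse blocks attains every slope strictly between `7 / 4` and `3` approximately.
One block `(4, 9)` and two blocks `(2, 5)` have the same number of vertices and numbers of edges
that differ by one, so the number of edges can be adjusted to the integer nearest to the desired
value (`FlowNet.exists_realizable`).
-/

namespace FlowNet

/-! ### Flows on networks -/

/-- A finite multigraph with a reference orientation: every edge is an arc from `src` to `tgt`. -/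
structure Net (V E : Type) where
  src : E → V
  tgt : E → V

namespace Net

variable {V E R : Type} [Fintype E] [CommRing R]

/-- The pairing of an edge weighting `f` with the coboundary of a potential `g`; equivalently, the
sum over all vertices of `g` times the net outflow of `f`. -/
def pairing (G : Net V E) (f : E → R) (g : V → R) : R :=
  ∑ e, f e * (g (G.src e) - g (G.tgt e))

/-- Flow conservation, in dual form: `f` annihilates the coboundary of every potential. Taking
indicator functions as potentials gives the conservation law at each vertex. -/
def IsFlow (G : Net V E) (f : E → R) : Prop := ∀ g : V → R, G.pairing f g = 0

end Net

/-- The values allowed on the edges of an integer nowhere-zero `3`-flow. -/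
def IsSmall (x : ℤ) : Prop := x = 1 ∨ x = -1 ∨ x = 2 ∨ x = -2

instance (x : ℤ) : Decidable (IsSmall x) := by unfold IsSmall; infer_instance

theorem isSmall_iff {x : ℤ} : IsSmall x ↔ 1 ≤ |x| ∧ |x| ≤ 2 := by
  unfold IsSmall
  rcases abs_cases x with h | h <;> omega

theorem IsSmall.neg {x : ℤ} (h : IsSmall x) : IsSmall (-x) := by
  unfold IsSmall at *; omega

theorem IsSmall.ne_zero {x : ℤ} (h : IsSmall x) : x ≠ 0 := by
  unfold IsSmall at *; omega

theorem IsSmall.cast_ne_zero {x : ℤ} (h : IsSmall x) : (x : ZMod 3) ≠ 0 := by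
  rcases h with rfl | rfl | rfl | rfl <;> decide

/-- The edges satisfying `X` carry the value zero and all others a value of modulus `1` or `2`. -/
def SmallOff {E : Type} (X : E → Prop) (f : E → ℤ) : Prop :=
  ∀ e, (X e → f e = 0) ∧ (¬ X e → IsSmall (f e))

/-- Criticality of a connected loopless multigraph in terms of edge deletions: there is no
nowhere-zero flow modulo `3`, but the deletion of any edge leaves a graph with an integer
nowhere-zero `3`-flow. Connectedness says that a vertex set which no edge leaves is empty or
everything. -/
structure Net.IsCritical {V E : Type} [Fintype E] (G : Net V E) : Prop where
  loopless : ∀ e, G.src e ≠ G.tgt e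
  connected : ∀ p : V → Prop, (∀ e, p (G.src e) ↔ p (G.tgt e)) → ∀ x y, p x → p y
  no_flow : ∀ f : E → ZMod 3, (∀ e, f e ≠ 0) → ¬ G.IsFlow f
  delete_flow : ∀ e, ∃ f : E → ℤ, SmallOff (· = e) f ∧ G.IsFlow f

/-! ### From nets to multigraphs -/

section ToGraph

variable {V E : Type}

/-- The multigraph underlying a net, with all of `V` as vertices and all of `E` as edges. -/
def Net.toGraph (G : Net V E) : Graph V E where
  vertexSet := Set.univ
  edgeSet := Set.univ
  IsLink e x y := (G.src e = x ∧ G.tgt e = y) ∨ (G.src e = y ∧ G.tgt e = x)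
  isLink_symm _ _ := ⟨fun _ _ h ↦ h.symm⟩
  eq_or_eq_of_isLink_of_isLink := by
    rintro e x y v w (⟨rfl, rfl⟩ | ⟨rfl, rfl⟩) (⟨h, h'⟩ | ⟨h, h'⟩) <;> simp_all
  edge_mem_iff_exists_isLink e := by
    simp only [Set.mem_univ, true_iff]
    exact ⟨_, _, Or.inl ⟨rfl, rfl⟩⟩
  left_mem_of_isLink := by simp

theorem Net.toGraph_isLink (G : Net V E) {e : E} {x y : V} :
    G.toGraph.IsLink e x y ↔ (G.src e = x ∧ G.tgt e = y) ∨ (G.src e = y ∧ G.tgt e = x) := Iff.rfl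

theorem Net.toGraph_isLink_src_tgt (G : Net V E) (e : E) :
    G.toGraph.IsLink e (G.src e) (G.tgt e) := Or.inl ⟨rfl, rfl⟩

theorem Net.toGraph_loopless (G : Net V E) (h : ∀ e, G.src e ≠ G.tgt e) :
    G.toGraph.Loopless := by
  refine ⟨fun e x hx ↦ ?_⟩
  rcases G.toGraph_isLink.1 hx with ⟨h₁, h₂⟩ | ⟨h₁, h₂⟩ <;> exact h e (h₁.trans h₂.symm)

theorem Net.toGraph_isConnected [Nonempty V] (G : Net V E)
    (h : ∀ p : V → Prop, (∀ e, p (G.src e) ↔ p (G.tgt e)) → ∀ x y, p x → p y) :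
    G.toGraph.IsConnected := by
  refine ⟨Set.univ_nonempty, fun x _ y _ ↦ ?_⟩
  refine h (fun z ↦ G.toGraph.Joined x z) (fun e ↦ ?_) x y Relation.ReflTransGen.refl
  exact ⟨fun hx ↦ hx.tail ⟨e, G.toGraph_isLink_src_tgt e⟩,
    fun hx ↦ hx.tail ⟨e, (G.toGraph_isLink_src_tgt e).symm⟩⟩

section Finsum

variable {ι W : Type} [Fintype ι]

theorem finsum_ends_eq_sum (t h : ι → W) (f : ι → ℤ) (w : W) [DecidableEq W] :
    (∑ᶠ (i : ι) (_ : t i = w), f i) - (∑ᶠ (i : ι) (_ : h i = w), f i) =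
      ∑ i, f i * ((if t i = w then 1 else 0) - (if h i = w then 1 else 0)) := by
  simp only [finsum_eq_if, finsum_eq_sum_of_fintype, ← Finset.sum_sub_distrib]
  refine Finset.sum_congr rfl fun i _ ↦ ?_
  split_ifs <;> simp

/-- Conservation at every vertex implies orthogonality to every potential. -/
theorem sum_mul_sub_eq_zero [Fintype W] (t h : ι → W) (f : ι → ℤ)
    (hf : ∀ w, (∑ᶠ (i : ι) (_ : t i = w), f i) - (∑ᶠ (i : ι) (_ : h i = w), f i) = 0)
    (g : W → ℤ) : ∑ i, f i * (g (t i) - g (h i)) = 0 := by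
  classical
  calc ∑ i, f i * (g (t i) - g (h i))
      = ∑ i, ∑ w, g w * (f i * ((if t i = w then 1 else 0) - (if h i = w then 1 else 0))) := by
        refine Finset.sum_congr rfl fun i _ ↦ ?_
        have e : ∀ x : W, ∑ w, g w * (if x = w then (1 : ℤ) else 0) = g x := by simp
        rw [← e (t i), ← e (h i), ← Finset.sum_sub_distrib, Finset.mul_sum]
        exact Finset.sum_congr rfl fun w _ ↦ by ring
    _ = ∑ w, g w * ∑ i, f i * ((if t i = w then 1 else 0) - (if h i = w then 1 else 0)) := by
        rw [Finset.sum_comm]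
        simp only [Finset.mul_sum]
    _ = 0 := by
        refine Finset.sum_eq_zero fun w _ ↦ ?_
        rw [← finsum_ends_eq_sum, hf, mul_zero]

end Finsum

variable [Fintype E]

/-- An integer nowhere-zero `3`-flow of the multigraph, for whatever orientation, reduces to a
nowhere-zero flow modulo `3` of the net. -/
theorem Net.IsCritical.not_hasNowhereZeroFlow [Fintype V] {G : Net V E} (hG : G.IsCritical) :
    ¬ G.toGraph.HasNowhereZeroFlow 3 := by
  classical
  rintro ⟨D, f, hflow, hf⟩
  let F : E → ℤ := fun e ↦
    if D.tail ⟨e, Set.mem_univ e⟩ = G.src e then f ⟨e, Set.mem_univ e⟩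
      else - f ⟨e, Set.mem_univ e⟩
  have hF : ∀ e, IsSmall (F e) := by
    intro e
    have h : IsSmall (f ⟨e, Set.mem_univ e⟩) := isSmall_iff.2 (hf _)
    simp only [F]
    split_ifs
    exacts [h, h.neg]
  have hterm : ∀ (g : V → ℤ) (e : E), F e * (g (G.src e) - g (G.tgt e)) =
      f ⟨e, Set.mem_univ e⟩ *
        (g (D.tail ⟨e, Set.mem_univ e⟩) - g (D.head ⟨e, Set.mem_univ e⟩)) := by
    intro g e
    simp only [F]
    rcases G.toGraph_isLink.1 (D.isLink ⟨e, Set.mem_univ e⟩) with ⟨h₁, h₂⟩ | ⟨h₁, h₂⟩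
    · rw [if_pos h₁.symm, h₁, h₂]
    · rw [if_neg (fun h ↦ hG.loopless e (h.symm.trans h₂.symm)), ← h₁, ← h₂]
      ring
  have hZ : ∀ g : V → ℤ, G.pairing F g = 0 := by
    intro g
    have h := sum_mul_sub_eq_zero (fun e ↦ D.tail ⟨e, Set.mem_univ e⟩)
      (fun e ↦ D.head ⟨e, Set.mem_univ e⟩) (fun e ↦ f ⟨e, Set.mem_univ e⟩) (fun w ↦ ?_) g
    · rw [← h]
      exact Finset.sum_congr rfl fun e _ ↦ hterm g e
    · have hw := hflow w (Set.mem_univ w)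
      let _ : Fintype E(G.toGraph) := inferInstanceAs (Fintype (Set.univ : Set E))
      rw [finsum_ends_eq_sum] at hw ⊢
      refine Eq.trans ?_ hw
      exact (Equiv.Set.univ E).symm.sum_comp (fun e : E(G.toGraph) ↦
        f e * ((if D.tail e = w then 1 else 0) - (if D.head e = w then 1 else 0)))
  refine hG.no_flow (fun e ↦ (F e : ZMod 3)) (fun e ↦ (hF e).cast_ne_zero) fun g ↦ ?_
  obtain ⟨g', rfl⟩ : ∃ g' : V → ℤ, g = fun v ↦ (g' v : ZMod 3) :=
    ⟨fun v ↦ (g v).val, by ext v; simp⟩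
  have h := congrArg (Int.cast : ℤ → ZMod 3) (hZ g')
  simpa [Net.pairing] using h

/-- A flow avoiding the edge `e` descends to the contraction of `e`: summing the conservation laws
over each class of identified vertices, the edges that become loops cancel. -/
theorem Net.IsCritical.contractEdge_hasNowhereZeroFlow {G : Net V E} (hG : G.IsCritical) (e : E) :
    (G.toGraph.contractEdge e).HasNowhereZeroFlow 3 := by
  classical
  obtain ⟨f, hf, hflow⟩ := hG.delete_flow e
  let φ : V → Set V := fun w ↦ {x | x = w ∨ G.toGraph.IsLink e w x}
  have hφe : φ (G.src e) = φ (G.tgt e) := by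
    have := hG.loopless e
    ext x
    simp only [φ, Set.mem_ofPred_eq, Net.toGraph_isLink]
    grind
  have hmem : ∀ i, i ∈ E(G.toGraph.contractEdge e) ↔ φ (G.src i) ≠ φ (G.tgt i) := by
    intro i
    simp only [Graph.contractEdge, Graph.edgeSet_deleteEdges, Graph.edgeSet_map, Set.mem_sdiff,
      Set.mem_ofPred_eq, Graph.map_isLoopAt, Net.toGraph_isLink]
    constructor
    · rintro ⟨-, h⟩ h'
      exact h ⟨_, _, _, Or.inl ⟨rfl, rfl⟩, rfl, h'.symm⟩
    · rintro h
      refine ⟨Set.mem_univ _, ?_⟩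
      rintro ⟨x, u, v, ⟨rfl, rfl⟩ | ⟨rfl, rfl⟩, h₁, h₂⟩
      · exact h (h₁.trans h₂.symm)
      · exact h (h₂.trans h₁.symm)
  refine ⟨⟨fun i ↦ φ (G.src i), fun i ↦ φ (G.tgt i), fun i ↦ ?_⟩, fun i ↦ f i, ?_, ?_⟩
  · have hi := (hmem i).1 i.2
    refine (Graph.deleteEdges_isLink _ _ _ _ _).mpr ⟨(G.toGraph_isLink_src_tgt i.1).map φ, ?_⟩
    rintro ⟨x, u, v, ⟨h, h'⟩ | ⟨h, h'⟩, h₁, h₂⟩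
    · exact hi (by rw [h, h']; exact h₁.trans h₂.symm)
    · exact hi (by rw [h, h']; exact h₂.trans h₁.symm)
  · intro X _
    let s : Finset E := Finset.univ.filter fun i ↦ i ∈ E(G.toGraph.contractEdge e)
    have hs : ∀ i, i ∈ s ↔ i ∈ E(G.toGraph.contractEdge e) := fun i ↦ by
      rw [Finset.mem_filter_univ]
    rw [finsum_ends_eq_sum]
    refine Eq.trans ?_ (hflow fun v ↦ if φ v = X then 1 else 0)
    refine (Finset.sum_subtype s hs fun i ↦ f i *
      ((if φ (G.src i) = X then 1 else 0) - (if φ (G.tgt i) = X then 1 else 0))).symm.trans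
      (Finset.sum_subset s.subset_univ ?_)
    intro i _ hi
    have : φ (G.src i) = φ (G.tgt i) := by
      by_contra h
      exact hi ((hs i).2 ((hmem i).2 h))
    simp [this]
  · intro i
    have hne : i.1 ≠ e := fun h ↦ (hmem i).1 i.2 (by rw [h, hφe])
    simpa using isSmall_iff.1 ((hf i).2 hne)

/-- In a critical net with a second edge `i`, the edge `e` lies in the support of a flow, hence is
not a bridge. -/
theorem Net.IsCritical.isBridgeless {G : Net V E} (hG : G.IsCritical)
    (hE : 1 < Fintype.card E) : G.toGraph.IsBridgeless := by
  classical
  rintro e ⟨x, y, hxy, hnot⟩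
  have := Fintype.one_lt_card_iff_nontrivial.1 hE
  obtain ⟨i, hi⟩ := exists_ne e
  obtain ⟨f, hf, hflow⟩ := hG.delete_flow i
  let p : V → Prop := fun z ↦ (G.toGraph.deleteEdges {e}).Joined x z
  have hp : ∀ j, j ≠ e → (p (G.src j) ↔ p (G.tgt j)) := by
    intro j hj
    have hl : (G.toGraph.deleteEdges {e}).IsLink j (G.src j) (G.tgt j) := by
      simp only [Graph.deleteEdges_isLink, Set.mem_singleton_iff]
      exact ⟨G.toGraph_isLink_src_tgt j, hj⟩
    exact ⟨fun h ↦ h.tail ⟨j, hl⟩, fun h ↦ h.tail ⟨j, hl.symm⟩⟩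
  have h := hflow fun v ↦ if p v then 1 else 0
  rw [Net.pairing, Finset.sum_eq_single e (fun j _ hj ↦ by simp [hp j hj]) (by simp)] at h
  have hfe : f e ≠ 0 := ((hf e).2 (Ne.symm hi)).ne_zero
  have hx : p x := Relation.ReflTransGen.refl
  rcases G.toGraph_isLink.1 hxy with ⟨rfl, rfl⟩ | ⟨rfl, rfl⟩
  · rw [if_pos hx, if_neg hnot] at h
    simp [hfe] at h
  · rw [if_pos hx, if_neg hnot] at h
    simp [hfe] at h

theorem Net.IsCritical.isThreeFlowCritical [Fintype V] {G : Net V E} (hG : G.IsCritical)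
    (hE : 1 < Fintype.card E) : G.toGraph.IsThreeFlowCritical where
  bridgeless := hG.isBridgeless hE
  no_flow := hG.not_hasNowhereZeroFlow
  contract_flow e _ := hG.contractEdge_hasNowhereZeroFlow e

end ToGraph

/-! ### Gluing along an edge -/

section Glue

variable {V₁ E₁ V₂ E₂ R : Type}

open Classical in
/-- Where a vertex of the second net goes when the edges `e₁` and `e₂` are identified. -/
noncomputable def glueMap (G₁ : Net V₁ E₁) (G₂ : Net V₂ E₂) (e₁ : E₁) (e₂ : E₂) (v : V₂) :
    V₁ ⊕ {v : V₂ // v ≠ G₂.src e₂ ∧ v ≠ G₂.tgt e₂} :=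
  if h : v = G₂.src e₂ then .inl (G₁.src e₁)
  else if h' : v = G₂.tgt e₂ then .inl (G₁.tgt e₁)
  else .inr ⟨v, h, h'⟩

/-- The union of two nets with the edge `e₂` of the second identified with the edge `e₁` of the
first. -/
noncomputable def glue (G₁ : Net V₁ E₁) (G₂ : Net V₂ E₂) (e₁ : E₁) (e₂ : E₂) :
    Net (V₁ ⊕ {v : V₂ // v ≠ G₂.src e₂ ∧ v ≠ G₂.tgt e₂}) (E₁ ⊕ {e : E₂ // e ≠ e₂}) where
  src := Sum.elim (fun e ↦ .inl (G₁.src e)) fun e ↦ glueMap G₁ G₂ e₁ e₂ (G₂.src e)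
  tgt := Sum.elim (fun e ↦ .inl (G₁.tgt e)) fun e ↦ glueMap G₁ G₂ e₁ e₂ (G₂.tgt e)

variable {G₁ : Net V₁ E₁} {G₂ : Net V₂ E₂} {e₁ : E₁} {e₂ : E₂}

theorem glueMap_src : glueMap G₁ G₂ e₁ e₂ (G₂.src e₂) = .inl (G₁.src e₁) := by
  simp [glueMap]

theorem glueMap_tgt (h : G₂.src e₂ ≠ G₂.tgt e₂) :
    glueMap G₁ G₂ e₁ e₂ (G₂.tgt e₂) = .inl (G₁.tgt e₁) := by
  simp [glueMap, h.symm]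

theorem glueMap_of_ne (v : {v : V₂ // v ≠ G₂.src e₂ ∧ v ≠ G₂.tgt e₂}) :
    glueMap G₁ G₂ e₁ e₂ v = .inr v := by
  simp [glueMap, v.2.1, v.2.2]

open Classical in
theorem glueMap_injective (h₁ : G₁.src e₁ ≠ G₁.tgt e₁) :
    Function.Injective (glueMap G₁ G₂ e₁ e₂) := by
  intro v w h
  unfold glueMap at h
  split_ifs at h <;> simp_all

variable [Fintype E₁] [Fintype E₂] [CommRing R]

open Classical in
theorem pairing_glue (f : E₁ ⊕ {e : E₂ // e ≠ e₂} → R) (f₂ : E₂ → R)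
    (hf : ∀ e : {e : E₂ // e ≠ e₂}, f₂ e = f (.inr e)) (g) (h : G₂.src e₂ ≠ G₂.tgt e₂) :
    (glue G₁ G₂ e₁ e₂).pairing f g =
      G₁.pairing (fun e ↦ f (.inl e)) (fun v ↦ g (.inl v)) +
      G₂.pairing f₂ (fun v ↦ g (glueMap G₁ G₂ e₁ e₂ v)) -
      f₂ e₂ * (g (.inl (G₁.src e₁)) - g (.inl (G₁.tgt e₁))) := by
  simp only [Net.pairing, Fintype.sum_sum_type]
  rw [Fintype.sum_eq_add_sum_subtype_ne _ e₂]
  simp only [glueMap_src, glueMap_tgt h, hf, glue, Sum.elim_inl, Sum.elim_inr]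
  ring

open Classical in
/-- Gluing preserves criticality. A nowhere-zero flow of the union would carry some value `d`
across the common edge inside the second net: if `d ≠ 0`, the edge `e₂` can carry it and the second
net has a flow; if `d = 0`, the first net has one. -/
theorem Net.IsCritical.glue (h₁ : G₁.IsCritical) (h₂ : G₂.IsCritical) (e₁ : E₁) (e₂ : E₂) :
    (glue G₁ G₂ e₁ e₂).IsCritical where
  loopless := by
    rintro (e | e)
    · simpa [FlowNet.glue] using h₁.loopless e
    · simpa [FlowNet.glue] using
        (glueMap_injective (h₁.loopless e₁)).ne (h₂.loopless e)
  connected := by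
    intro p hp
    have hp₁ : ∀ x y, p (.inl x) → p (.inl y) :=
      h₁.connected (fun v ↦ p (.inl v)) fun e ↦ hp (.inl e)
    have hp₂ : ∀ x y, p (glueMap G₁ G₂ e₁ e₂ x) → p (glueMap G₁ G₂ e₁ e₂ y) := by
      refine h₂.connected (fun v ↦ p (glueMap G₁ G₂ e₁ e₂ v)) fun e ↦ ?_
      by_cases he : e = e₂
      · subst he
        rw [glueMap_src, glueMap_tgt (h₂.loopless e)]
        exact ⟨hp₁ _ _, hp₁ _ _⟩
      · exact hp (.inr ⟨e, he⟩)
    have key : ∀ x, p x ↔ p (.inl (G₁.src e₁)) := by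
      rintro (x | x)
      · exact ⟨hp₁ _ _, hp₁ _ _⟩
      · rw [← glueMap_of_ne x, ← glueMap_src (G₂ := G₂) (e₂ := e₂)]
        exact ⟨hp₂ _ _, hp₂ _ _⟩
    exact fun x y hx ↦ (key y).2 ((key x).1 hx)
  no_flow := by
    intro f hf hflow
    let f₁ : E₁ → ZMod 3 := fun e ↦ f (.inl e)
    -- The part of the flow on the second net, with the value `d` put on `e₂`.
    let f₂ : ZMod 3 → E₂ → ZMod 3 := fun d e ↦ if h : e = e₂ then d else f (.inr ⟨e, h⟩)
    have hf₂ : ∀ d (e : {e : E₂ // e ≠ e₂}), f₂ d e = f (.inr e) := fun d e ↦ by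
      simp [f₂, e.2]
    let d : ZMod 3 := G₁.pairing f₁ fun v ↦ if v = G₁.src e₁ then 1 else 0
    have hmatch : ∀ (g₁ : V₁ → ZMod 3) (g₂ : V₂ → ZMod 3), g₁ (G₁.src e₁) = g₂ (G₂.src e₂) →
        g₁ (G₁.tgt e₁) = g₂ (G₂.tgt e₂) → ∀ c, G₁.pairing f₁ g₁ + G₂.pairing (f₂ c) g₂ -
          c * (g₂ (G₂.src e₂) - g₂ (G₂.tgt e₂)) = 0 := by
      intro g₁ g₂ hs ht c
      have := pairing_glue (G₁ := G₁) (e₁ := e₁) f (f₂ c) (hf₂ c) (Sum.elim g₁ fun v ↦ g₂ v)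
        (h₂.loopless e₂)
      rw [hflow] at this
      have hg : (fun v ↦ Sum.elim g₁ (fun v ↦ g₂ v.1) (glueMap G₁ G₂ e₁ e₂ v)) = g₂ := by
        ext v
        by_cases hv : v = G₂.src e₂
        · rw [hv, glueMap_src, Sum.elim_inl, hs]
        by_cases hv' : v = G₂.tgt e₂
        · rw [hv', glueMap_tgt (h₂.loopless e₂), Sum.elim_inl, ht]
        · rw [glueMap_of_ne ⟨v, hv, hv'⟩, Sum.elim_inr]
      rw [hg] at this
      simp only [Sum.elim_inl, hs, ht] at this
      simpa [f₂] using this.symm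
    have key : G₂.IsFlow (f₂ d) := by
      intro g₂
      let a := g₂ (G₂.src e₂)
      let b := g₂ (G₂.tgt e₂)
      have h := hmatch (fun v ↦ if v = G₁.src e₁ then a else b) g₂ (by simp [a])
        (by simp [b, (h₁.loopless e₁).symm]) d
      have h' : G₁.pairing f₁ (fun v ↦ if v = G₁.src e₁ then a else b) = d * (a - b) := by
        simp only [d, Net.pairing, Finset.sum_mul]
        refine Finset.sum_congr rfl fun e _ ↦ ?_
        split_ifs <;> ring
      rw [h'] at h
      linear_combination h
    by_cases hd : d = 0
    · refine h₁.no_flow f₁ (fun e ↦ hf _) fun g₁ ↦ ?_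
      have h := hmatch g₁
        (fun v ↦ if v = G₂.src e₂ then g₁ (G₁.src e₁) else g₁ (G₁.tgt e₁)) (by simp)
        (by simp [(h₂.loopless e₂).symm]) d
      rwa [key, hd, zero_mul, add_zero, sub_zero] at h
    · refine h₂.no_flow (f₂ d) (fun e ↦ ?_) key
      simp only [f₂]
      split_ifs
      exacts [hd, hf _]
  delete_flow := by
    rintro (e | ⟨e, he⟩)
    · obtain ⟨f₁, hf₁, hflow₁⟩ := h₁.delete_flow e
      obtain ⟨f₂, hf₂, hflow₂⟩ := h₂.delete_flow e₂
      refine ⟨Sum.elim f₁ fun e ↦ f₂ e, ?_, fun g ↦ ?_⟩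
      · rintro (i | i)
        · simpa using hf₁ i
        · simpa using (hf₂ i).2 i.2
      · rw [pairing_glue _ f₂ (fun _ ↦ rfl) g (h₂.loopless e₂), hflow₂, (hf₂ e₂).1 rfl]
        simpa using hflow₁ _
    · obtain ⟨f₁, hf₁, hflow₁⟩ := h₁.delete_flow e₁
      obtain ⟨f₂, hf₂, hflow₂⟩ := h₂.delete_flow e
      refine ⟨Sum.elim (f₁ + Pi.single e₁ (f₂ e₂)) fun e ↦ f₂ e, ?_, fun g ↦ ?_⟩
      · rintro (i | i)
        · refine ⟨fun h ↦ by simp at h, fun _ ↦ ?_⟩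
          by_cases hi : i = e₁
          · subst hi
            simpa [(hf₁ i).1 rfl] using (hf₂ e₂).2 (Ne.symm he)
          · simpa [hi] using (hf₁ i).2 hi
        · have := hf₂ i
          simpa [Subtype.ext_iff] using this
      · rw [pairing_glue _ f₂ (fun _ ↦ rfl) g (h₂.loopless e₂), hflow₂]
        have h := hflow₁ fun v ↦ g (.inl v)
        simp only [Net.pairing, Sum.elim_inl, Pi.add_apply, add_mul, Finset.sum_add_distrib] at h ⊢
        rw [h, Finset.sum_eq_single e₁ (fun j _ hj ↦ by simp [hj]) (by simp)]
        simp

end Glue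

/-- There is a critical net with `a + 2` vertices and `b + 1` edges. With this normalization the
pairs `(a, b)` are closed under addition, by gluing along an edge. -/
def Realizable (a b : ℕ) : Prop :=
  ∃ (V E : Type) (_ : Fintype V) (_ : Fintype E) (G : Net V E),
    Fintype.card V = a + 2 ∧ Fintype.card E = b + 1 ∧ G.IsCritical

theorem Realizable.add {a b a' b' : ℕ} (h : Realizable a b) (h' : Realizable a' b') :
    Realizable (a + a') (b + b') := by
  classical
  obtain ⟨V₁, E₁, _, _, G₁, hV₁, hE₁, hG₁⟩ := h
  obtain ⟨V₂, E₂, _, _, G₂, hV₂, hE₂, hG₂⟩ := h'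
  obtain ⟨e₁⟩ : Nonempty E₁ := Fintype.card_pos_iff.1 (by omega)
  obtain ⟨e₂⟩ : Nonempty E₂ := Fintype.card_pos_iff.1 (by omega)
  refine ⟨_, _, inferInstance, inferInstance, glue G₁ G₂ e₁ e₂, ?_, ?_, hG₁.glue hG₂ e₁ e₂⟩
  · have hc : Fintype.card {v : V₂ // v ≠ G₂.src e₂ ∧ v ≠ G₂.tgt e₂} = a' := by
      rw [Fintype.card_subtype]
      have : (Finset.univ.filter fun v ↦ v ≠ G₂.src e₂ ∧ v ≠ G₂.tgt e₂) =
          Finset.univ \ {G₂.src e₂, G₂.tgt e₂} := by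
        ext v; simp
      rw [this, Finset.card_sdiff_of_subset (Finset.subset_univ _), Finset.card_univ, hV₂,
        Finset.card_pair (hG₂.loopless e₂)]
      omega
    rw [Fintype.card_sum, hV₁, hc]
    ring
  · have hc : Fintype.card {e : E₂ // e ≠ e₂} = b' := by
      rw [Fintype.card_subtype_compl, hE₂, Fintype.card_subtype_eq]
      omega
    rw [Fintype.card_sum, hE₁, hc]
    ring

/-! ### The complete graph on four vertices -/

/-- The complete graph on four vertices. -/
def k4 : Net (Fin 4) (Fin 6) where
  src := ![0, 0, 0, 1, 1, 2]
  tgt := ![1, 2, 3, 2, 3, 3]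

/-- The row of `e` is a flow of the complete graph on four vertices that avoids the edge `e`. -/
def k4Flow : Fin 6 → Fin 6 → ℤ :=
  ![![0, 1, -1, 1, -1, 2],
    ![1, 0, -1, -1, 2, -1],
    ![1, -1, 0, 2, -1, 1],
    ![1, 1, -2, 0, 1, 1],
    ![1, -2, 1, 1, 0, -1],
    ![2, -1, -1, 1, 1, 0]]

/-- Modulo `3`, the three values leaving a vertex of degree three coincide, which is impossible
around a triangle of such vertices. -/
theorem k4_isCritical : k4.IsCritical where
  loopless := by decide
  connected p hp := by
    have h₁ := hp 0
    have h₂ := hp 1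
    have h₃ := hp 2
    simp only [k4, Matrix.cons_val] at h₁ h₂ h₃
    intro x y hx
    fin_cases x <;> fin_cases y <;> simp_all
  no_flow f hf h := by
    have key : ∀ a b c d e k : ZMod 3, a ≠ 0 → b ≠ 0 → c ≠ 0 → d ≠ 0 → e ≠ 0 → k ≠ 0 →
        a + (b + c) = 0 → -a + (d + e) = 0 → -b + (-d + k) ≠ 0 := by decide
    have h₀ := h (Pi.single 0 1)
    have h₁ := h (Pi.single 1 1)
    have h₂ := h (Pi.single 2 1)
    simp [Net.pairing, k4, Fin.sum_univ_succ, Pi.single_apply] at h₀ h₁ h₂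
    exact key _ _ _ _ _ _ (hf 0) (hf 1) (hf 2) (hf 3) (hf 4) (hf 5) h₀ h₁ h₂
  delete_flow e := by
    refine ⟨k4Flow e, by unfold SmallOff; revert e; decide, fun g ↦ ?_⟩
    fin_cases e <;> simp [Net.pairing, k4, k4Flow, Fin.sum_univ_succ] <;> ring

/-! ### Complete bipartite graphs with an extra edge -/

/-- The complete bipartite graph between three hubs and the index set `ι`, together with an edge
joining the first two hubs. -/
def bipartite (ι : Type) : Net (Fin 3 ⊕ ι) (Option (ι × Fin 3)) where
  src e := e.elim (.inl 0) fun x ↦ .inr x.1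
  tgt e := e.elim (.inl 1) fun x ↦ .inl x.2

theorem pairing_bipartite {ι R : Type} [Fintype ι] [CommRing R] (f : Option (ι × Fin 3) → R)
    (g : Fin 3 ⊕ ι → R) :
    (bipartite ι).pairing f g = f none * (g (.inl 0) - g (.inl 1)) +
      ∑ i, ∑ j, f (some (i, j)) * (g (.inr i) - g (.inl j)) := by
  simp [Net.pairing, bipartite, Fintype.sum_option, Fintype.sum_prod_type]

/-- An assignment of values to the edges is a flow if it is conserved at the vertices of `ι` and
at the hubs. -/
theorem isFlow_bipartite {ι : Type} [Fintype ι] (c : ℤ) (r : ι → Fin 3 → ℤ)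
    (hr : ∀ i, ∑ j, r i j = 0) (hc : ∀ j, ∑ i, r i j = ![c, -c, 0] j) :
    (bipartite ι).IsFlow fun e ↦ e.elim c fun x ↦ r x.1 x.2 := by
  intro g
  rw [pairing_bipartite]
  simp only [Option.elim, mul_sub, Finset.sum_sub_distrib, ← Finset.sum_mul, hr]
  rw [Finset.sum_comm]
  simp only [← Finset.sum_mul, hc]
  simp only [Fin.sum_univ_three, Matrix.cons_val, zero_mul, Finset.sum_const_zero]
  ring

/-- Modulo `3`, each vertex of `ι` sends the same value to all hubs, so the third hub forces the
total received by the first hub to vanish, and nothing is left for the extra edge. -/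
theorem bipartite_no_flow {ι : Type} [Fintype ι] (f : Option (ι × Fin 3) → ZMod 3)
    (hf : ∀ e, f e ≠ 0) : ¬ (bipartite ι).IsFlow f := by
  classical
  intro h
  have hrow : ∀ i, f (some (i, 0)) = f (some (i, 2)) := by
    intro i
    have hi := h (Sum.elim 0 (Pi.single i 1))
    rw [pairing_bipartite, Finset.sum_eq_single i (fun j _ hj ↦ by simp [hj]) (by simp)] at hi
    simp only [Sum.elim_inl, Sum.elim_inr, Pi.single_eq_same, Fin.sum_univ_three, Pi.zero_apply,
      sub_zero, mul_one, mul_zero, zero_add] at hi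
    have h₀ := hf (some (i, 0))
    have h₁ := hf (some (i, 1))
    have h₂ := hf (some (i, 2))
    generalize f (some (i, 0)) = a at *
    generalize f (some (i, 1)) = b at *
    generalize f (some (i, 2)) = c at *
    revert a b c
    decide
  have h₂ := h (Sum.elim (Pi.single 2 1) 0)
  have h₀ := h (Sum.elim (Pi.single 0 1) 0)
  rw [pairing_bipartite] at h₀ h₂
  simp [Pi.single_apply, hrow] at h₀ h₂
  rw [h₂] at h₀
  exact hf none (by simpa using h₀)

/-- The values at three vertices of `ι` in a flow avoiding one edge: the edge joining the two hubs,
or the edge from the first of the three vertices to the given hub. -/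
def bipartiteRows : Option (Fin 3) → Fin 3 → Fin 3 → ℤ
  | none => ![![1, 1, -2], ![1, -2, 1], ![-2, 1, 1]]
  | some 0 => ![![0, -1, 1], ![1, 1, -2], ![-2, 1, 1]]
  | some 1 => ![![-1, 0, 1], ![1, 1, -2], ![1, -2, 1]]
  | some 2 => ![![1, -1, 0], ![1, 1, -2], ![-1, -1, 2]]

/-- The remaining vertices of `ι` come in pairs with opposite values. -/
def bipartiteFlow {s : ℕ} (d : Option (Fin 3)) : Fin 3 ⊕ Fin s × Bool → Fin 3 → ℤ
  | .inl k => bipartiteRows d k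
  | .inr (_, true) => ![1, 1, -2]
  | .inr (_, false) => ![-1, -1, 2]

/-- The value on the edge joining two hubs that goes with `bipartiteRows`. -/
def bipartiteHub : Option (Fin 3) → ℤ
  | none => 0
  | some 0 => -1
  | some 1 => 1
  | some 2 => 1

theorem sum_bipartiteFlow_row {s : ℕ} (d : Option (Fin 3)) (i : Fin 3 ⊕ Fin s × Bool) :
    ∑ j, bipartiteFlow d i j = 0 := by
  rcases i with k | ⟨_, _ | _⟩
  · simp only [bipartiteFlow]; revert d k; decide
  · simp only [bipartiteFlow]; decide
  · simp only [bipartiteFlow]; decide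

theorem sum_bipartiteFlow_col {s : ℕ} (d : Option (Fin 3)) (j : Fin 3) :
    ∑ i : Fin 3 ⊕ Fin s × Bool, bipartiteFlow d i j =
      ![bipartiteHub d, -bipartiteHub d, 0] j := by
  have h : (![1, 1, -2] : Fin 3 → ℤ) j + ![-1, -1, 2] j = 0 := by revert j; decide
  rw [Fintype.sum_sum_type, Fintype.sum_prod_type]
  simp only [bipartiteFlow, Fintype.sum_bool, h, Finset.sum_const_zero, add_zero]
  revert d j
  decide

theorem bipartite_isCritical (s : ℕ) : (bipartite (Fin 3 ⊕ Fin s × Bool)).IsCritical where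
  loopless e := by
    rcases e with _ | e <;> simp [bipartite]
  connected p hp := by
    have h : ∀ i j, p (.inr i) ↔ p (.inl j) := fun i j ↦ hp (some (i, j))
    have key : ∀ x, p x ↔ p (.inl 0) := by
      rintro (j | i)
      · exact (h (.inl 0) j).symm.trans (h (.inl 0) 0)
      · exact h i 0
    exact fun x y hx ↦ (key y).2 ((key x).1 hx)
  no_flow := bipartite_no_flow
  delete_flow e := by
    classical
    rcases e with _ | ⟨i, j⟩
    · refine ⟨_, ?_, isFlow_bipartite (bipartiteHub none) (bipartiteFlow none)
        (sum_bipartiteFlow_row _) (sum_bipartiteFlow_col _)⟩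
      rintro (_ | ⟨k | ⟨_, _ | _⟩, j⟩)
      · simp [bipartiteHub]
      · simp only [Option.elim, bipartiteFlow, reduceCtorEq, false_implies, not_false_eq_true,
          true_implies, true_and]
        revert k j; decide
      all_goals
        simp only [Option.elim, bipartiteFlow, reduceCtorEq, false_implies, not_false_eq_true,
          true_implies, true_and]
        revert j; decide
    · -- A permutation of `ι` moves the vertex of the deleted edge to the first place.
      let σ := Equiv.swap i (.inl 0)
      refine ⟨_, ?_, isFlow_bipartite (bipartiteHub (some j))
        (fun k ↦ bipartiteFlow (some j) (σ k)) (fun k ↦ sum_bipartiteFlow_row _ _) fun k ↦ ?_⟩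
      · have hz : bipartiteFlow (s := s) (some j) (.inl 0) j = 0 := by
          simp only [bipartiteFlow]
          revert j; decide
        have hn : ∀ k l, ¬ (k = .inl 0 ∧ l = j) → IsSmall (bipartiteFlow (s := s) (some j) k l) := by
          rintro (k | ⟨_, _ | _⟩) l h
          · simp only [bipartiteFlow, Sum.inl.injEq] at h ⊢
            clear hz
            revert j k l; decide
          all_goals
            simp only [bipartiteFlow]
            clear h
            revert l; decide
        rintro (_ | ⟨k, l⟩)
        · refine ⟨fun h ↦ by simp at h, fun _ ↦ ?_⟩
          have : ∀ j, IsSmall (bipartiteHub (some j)) := by decide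
          exact this j
        · refine ⟨fun h ↦ ?_, fun h ↦ hn _ _ fun h' ↦ h ?_⟩
          · obtain ⟨rfl, rfl⟩ : k = i ∧ l = j := by simpa using h
            simpa [σ] using hz
          · have hk : k = i := by
              have := congrArg σ h'.1
              simpa [σ] using this
            exact congrArg some (Prod.ext hk h'.2)
      · exact (Equiv.sum_comp σ fun k' ↦ bipartiteFlow (some j) k' k).trans (sum_bipartiteFlow_col _ _)

theorem realizable_k4 : Realizable 2 5 :=
  ⟨_, _, inferInstance, inferInstance, k4, by simp, by simp, k4_isCritical⟩

theorem realizable_bipartite (s : ℕ) : Realizable (2 * s + 4) (6 * s + 9) := by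
  refine ⟨_, _, inferInstance, inferInstance, _, ?_, ?_, bipartite_isCritical s⟩ <;>
    simp <;> ring

/-! ### Networks with six terminals -/

/-- A net with six half-edges: the `j`-th half-edge leaves the vertex `term j`. -/
structure Pole (V E : Type) extends Net V E where
  term : Fin 6 → V

theorem SmallOff.neg {E : Type} {X : E → Prop} {f : E → ℤ} (h : SmallOff X f) : SmallOff X (-f) :=
  fun e ↦ ⟨fun he ↦ by simp [(h e).1 he], fun he ↦ ((h e).2 he).neg⟩

theorem SmallOff.congr {E : Type} {X Y : E → Prop} {f : E → ℤ} (h : SmallOff X f) (hXY : ∀ e, Y e ↔ X e) :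
    SmallOff Y f :=
  fun e ↦ ⟨fun he ↦ (h e).1 ((hXY e).1 he), fun he ↦ (h e).2 fun he' ↦ he ((hXY e).2 he')⟩

theorem SmallOff.sumElim {E F : Type} {X : E → Prop} {Y : F → Prop} {f : E → ℤ} {u : F → ℤ}
    (h : SmallOff X f) (h' : SmallOff Y u) : SmallOff (Sum.elim X Y) (Sum.elim f u) := by
  rintro (e | e)
  exacts [h e, h' e]

section Pole

variable {V E R : Type} [Fintype E] [CommRing R]

/-- `f` is conserved at every vertex when the `j`-th half-edge carries the value `b j` outwards. -/
def Pole.IsFlow (P : Pole V E) (f : E → R) (b : Fin 6 → R) : Prop :=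
  ∀ g : V → R, P.pairing f g + ∑ j, b j * g (P.term j) = 0

/-- Some integer flow vanishing exactly on the edges satisfying `X`, with values of modulus `1` or
`2` elsewhere, has the boundary values `b`. -/
def Pole.Reach (P : Pole V E) (X : E → Prop) (b : Fin 6 → ℤ) : Prop :=
  ∃ f : E → ℤ, SmallOff X f ∧ P.IsFlow f b

theorem Pole.Reach.congr {P : Pole V E} {X Y : E → Prop} {b : Fin 6 → ℤ} (h : P.Reach X b)
    (hXY : ∀ e, Y e ↔ X e) : P.Reach Y b := by
  obtain ⟨f, hf, hflow⟩ := h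
  exact ⟨f, hf.congr hXY, hflow⟩

theorem Pole.Reach.neg {P : Pole V E} {X : E → Prop} {b : Fin 6 → ℤ} (h : P.Reach X b) :
    P.Reach X (-b) := by
  obtain ⟨f, hf, hflow⟩ := h
  refine ⟨-f, hf.neg, fun g ↦ ?_⟩
  have := hflow g
  simp only [Net.pairing, Pi.neg_apply, neg_mul, Finset.sum_neg_distrib] at this ⊢
  linear_combination -this

theorem Pole.IsFlow.sum_eq_zero {P : Pole V E} {f : E → R} {b : Fin 6 → R} (h : P.IsFlow f b) :
    ∑ j, b j = 0 := by
  simpa [Net.pairing] using h 1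

end Pole

/-! ### The unit and its boundary states -/

/-- Attach a path `1 - 2 - 3 - 0` of four new vertices to the first four half-edges of a pole. The
new half-edges are the last two old ones and one half-edge at each new vertex. -/
def Pole.addUnit {V E : Type} (P : Pole V E) : Pole (V ⊕ Fin 4) (E ⊕ Fin 7) where
  src := Sum.elim (fun e ↦ .inl (P.src e))
    ![.inl (P.term 0), .inl (P.term 1), .inl (P.term 2), .inl (P.term 3), .inr 0, .inr 1, .inr 2]
  tgt := Sum.elim (fun e ↦ .inl (P.tgt e))
    ![.inr 0, .inr 1, .inr 2, .inr 3, .inr 3, .inr 2, .inr 3]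
  term := ![.inl (P.term 5), .inl (P.term 4), .inr 0, .inr 2, .inr 1, .inr 3]

section Unit

variable {V E R : Type} [Fintype E] [CommRing R]

/-- The flow condition for a pole with a unit attached: the flow condition for the pole, and
conservation at the four new vertices. -/
theorem isFlow_addUnit (P : Pole V E) (f : E → R) (u : Fin 7 → R) (b : Fin 6 → R) :
    P.addUnit.IsFlow (Sum.elim f u) b ↔
      P.IsFlow f ![u 0, u 1, u 2, u 3, b 1, b 0] ∧
      u 4 + b 2 = u 0 ∧ u 5 + b 4 = u 1 ∧ u 6 + b 3 = u 2 + u 5 ∧ b 5 = u 3 + u 4 + u 6 := by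
  have key : ∀ g : V ⊕ Fin 4 → R,
      P.addUnit.pairing (Sum.elim f u) g + ∑ j, b j * g (P.addUnit.term j) =
      (P.pairing f (fun v ↦ g (.inl v)) +
        ∑ j, ![u 0, u 1, u 2, u 3, b 1, b 0] j * g (.inl (P.term j))) +
      (u 4 + b 2 - u 0) * g (.inr 0) + (u 5 + b 4 - u 1) * g (.inr 1) +
      (u 6 + b 3 - u 2 - u 5) * g (.inr 2) + (b 5 - u 3 - u 4 - u 6) * g (.inr 3) := by
    intro g
    simp only [Net.pairing, Fintype.sum_sum_type, Fin.sum_univ_six, Fin.sum_univ_seven,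
      Pole.addUnit, Sum.elim_inl, Sum.elim_inr, Matrix.cons_val]
    ring
  constructor
  · intro h
    have h' : ∀ g, _ = (0 : R) := fun g ↦ (key g).symm.trans (h g)
    refine ⟨fun g ↦ by simpa using h' (Sum.elim g 0), ?_, ?_, ?_, ?_⟩
    · have := h' (Sum.elim 0 (Pi.single 0 1))
      simp [Net.pairing] at this
      linear_combination this
    · have := h' (Sum.elim 0 (Pi.single 1 1))
      simp [Net.pairing] at this
      linear_combination this
    · have := h' (Sum.elim 0 (Pi.single 2 1))
      simp [Net.pairing] at this
      linear_combination this
    · have := h' (Sum.elim 0 (Pi.single 3 1))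
      simp [Net.pairing] at this
      linear_combination this
  · rintro ⟨h, h₀, h₁, h₂, h₃⟩ g
    rw [key, h]
    linear_combination h₀ * g (.inr 0) + h₁ * g (.inr 1) + h₂ * g (.inr 2) + h₃ * g (.inr 3)

/-- The values on the edges of a unit determined by the old boundary values `s` and the new ones
`b`. -/
def unitEdges (s b : Fin 6 → ℤ) : Fin 7 → ℤ :=
  ![s 0, s 1, s 2, s 3, s 0 - b 2, s 1 - b 4, s 2 + (s 1 - b 4) - b 3]

/-- A unit can turn the boundary values `s` into `b`, with exactly the edges in `Y` carrying zero. -/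
def UnitStep (Y : Fin 7 → Prop) (s b : Fin 6 → ℤ) : Prop :=
  b 0 = s 5 ∧ b 1 = s 4 ∧ b 5 = s 3 + unitEdges s b 4 + unitEdges s b 6 ∧
    SmallOff Y (unitEdges s b)

instance (Y : Fin 7 → Prop) [DecidablePred Y] (s b : Fin 6 → ℤ) : Decidable (UnitStep Y s b) := by
  unfold UnitStep SmallOff; infer_instance

theorem Pole.Reach.addUnit {P : Pole V E} {X : E → Prop} {Y : Fin 7 → Prop} {s b : Fin 6 → ℤ}
    (h : P.Reach X s) (hs : UnitStep Y s b) : P.addUnit.Reach (Sum.elim X Y) b := by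
  obtain ⟨f, hf, hflow⟩ := h
  obtain ⟨h₀, h₁, h₅, hu⟩ := hs
  refine ⟨Sum.elim f (unitEdges s b), hf.sumElim hu, ?_⟩
  rw [isFlow_addUnit]
  refine ⟨?_, ?_, ?_, ?_, h₅⟩
  · convert hflow
    ext j
    fin_cases j <;> simp [unitEdges, h₀, h₁]
  all_goals
    simp only [unitEdges, Matrix.cons_val]
    ring

end Unit

/-- Boundary values that become available once an edge of the pole has been deleted. -/
def deletionStates : List (Fin 6 → ℤ) :=
  [![2, -2, -1, 1, -1, 1], ![1, -1, 1, -1, -1, 1], ![1, -1, -1, 1, -1, 1], ![1, -1, 2, -2, 1, -1]]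

/-- What the induction along a chain of units keeps track of. Modulo `3`, the first two half-edges
carry equal values. The boundary values in the list `S` are available. After the deletion of any
edge, some state in `deletionStates` is available, and there the first two half-edges carry
different values modulo `3`. A zero entry in a member of `S` corresponds to the deletion of the
edge that will be formed by this half-edge. -/
structure Pole.Good {V E : Type} [Fintype E] (S : List (Fin 6 → ℤ)) (P : Pole V E) : Prop where
  loopless : ∀ e, P.src e ≠ P.tgt e
  connected : ∀ p : V → Prop, (∀ e, p (P.src e) ↔ p (P.tgt e)) → ∀ x y, p x → p y
  parity : ∀ (f : E → ZMod 3) (b : Fin 6 → ZMod 3), (∀ e, f e ≠ 0) → (∀ j, b j ≠ 0) →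
    P.IsFlow f b → b 0 = b 1
  reach : ∀ s ∈ S, P.Reach (fun _ ↦ False) s
  reach_delete : ∀ e, ∃ s ∈ deletionStates, P.Reach (· = e) s

/-- Every member of `T` is obtained from a member of `S` by a unit, and the deletion of any edge of
the unit leads from some member of `S` to a deletion state; all up to a global change of sign. -/
def Advances (S T : List (Fin 6 → ℤ)) : Prop :=
  (∀ t ∈ T, ∃ s ∈ S, UnitStep (fun _ ↦ False) s t ∨ UnitStep (fun _ ↦ False) (-s) t) ∧
  ∀ i, ∃ s ∈ S, ∃ t ∈ deletionStates, UnitStep (· = i) s t ∨ UnitStep (· = i) (-s) t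

instance (S T : List (Fin 6 → ℤ)) : Decidable (Advances S T) := by
  unfold Advances; infer_instance

theorem deletionStates_step : ∀ s ∈ deletionStates, ∃ t ∈ deletionStates,
    UnitStep (fun _ ↦ False) s t ∨ UnitStep (fun _ ↦ False) (-s) t := by
  decide

theorem reach_addUnit_of_or {V E : Type} [Fintype E] {P : Pole V E} {X : E → Prop}
    {Y : Fin 7 → Prop} {s t : Fin 6 → ℤ} (h : P.Reach X s)
    (hs : UnitStep Y s t ∨ UnitStep Y (-s) t) : P.addUnit.Reach (Sum.elim X Y) t :=
  hs.elim h.addUnit h.neg.addUnit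

theorem Pole.Good.addUnit {V E : Type} [Fintype E] {S T : List (Fin 6 → ℤ)} {P : Pole V E}
    (h : P.Good S) (hST : Advances S T) : P.addUnit.Good T where
  loopless := by
    rintro (e | i)
    · simpa [Pole.addUnit] using h.loopless e
    · fin_cases i <;> simp [Pole.addUnit]
  connected := by
    intro p hp
    have hP : ∀ x y, p (.inl x) → p (.inl y) :=
      h.connected (fun v ↦ p (.inl v)) fun e ↦ hp (.inl e)
    have key : ∀ x, p x ↔ p (.inl (P.term 0)) := by
      have h₀ : p (.inl (P.term 0)) ↔ p (.inr 0) := hp (.inr 0)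
      have h₁ : p (.inl (P.term 1)) ↔ p (.inr 1) := hp (.inr 1)
      have h₂ : p (.inl (P.term 2)) ↔ p (.inr 2) := hp (.inr 2)
      have h₃ : p (.inl (P.term 3)) ↔ p (.inr 3) := hp (.inr 3)
      rintro (x | i)
      · exact ⟨hP _ _, hP _ _⟩
      · fin_cases i
        exacts [h₀.symm, h₁.symm.trans ⟨hP _ _, hP _ _⟩, h₂.symm.trans ⟨hP _ _, hP _ _⟩,
          h₃.symm.trans ⟨hP _ _, hP _ _⟩]
    exact fun x y hx ↦ (key y).2 ((key x).1 hx)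
  parity := by
    intro f b hf hb hflow
    have hf' : f = Sum.elim (fun e ↦ f (.inl e)) fun i ↦ f (.inr i) := by
      ext (e | i) <;> rfl
    rw [hf', isFlow_addUnit] at hflow
    obtain ⟨hP, h₀, h₁, h₂, h₃⟩ := hflow
    have hu : ∀ i, f (.inr i) ≠ 0 := fun i ↦ hf _
    have heq := h.parity _ _ (fun e ↦ hf _) (fun j ↦ by
      fin_cases j
      exacts [hu 0, hu 1, hu 2, hu 3, hb 1, hb 0]) hP
    have hsum := hP.sum_eq_zero
    simp only [Fin.sum_univ_six, Matrix.cons_val] at hsum heq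
    -- A vertex of degree three passes on the opposite of what it receives.
    have cubic : ∀ x y z : ZMod 3, x ≠ 0 → y ≠ 0 → z ≠ 0 → x + y = z → x = -z := by decide
    have h₄ := cubic _ _ _ (hu 4) (hb 2) (hu 0) h₀
    have h₅ := cubic _ _ _ (hu 5) (hb 4) (hu 1) h₁
    -- Hence the third and fourth values cannot both be opposite to the first two.
    have quartic : ∀ a c d w : ZMod 3, w ≠ 0 → c + -a - w ≠ 0 → d + -a + w ≠ 0 →
        a ≠ 0 → c = -a → d ≠ -a := by decide
    have parity : ∀ a c d x y : ZMod 3, a ≠ 0 → c ≠ 0 → d ≠ 0 → x ≠ 0 → y ≠ 0 →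
        (c = -a → d ≠ -a) → a + a + c + d + x + y = 0 → y = x := by decide
    rw [h₄, heq] at h₃
    rw [h₅] at h₂
    rw [heq] at hsum
    refine parity _ _ _ _ _ (hu 1) (hu 2) (hu 3) (hb 1) (hb 0)
      (quartic _ _ _ _ (hu 6) ?_ ?_ (hu 1)) hsum
    · rw [← h₂, add_sub_cancel_left]
      exact hb 3
    · rw [← h₃]
      exact hb 5
  reach := by
    intro t ht
    obtain ⟨s, hs, hst⟩ := hST.1 t ht
    exact (reach_addUnit_of_or (h.reach s hs) hst).congr (by rintro (e | i) <;> simp)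
  reach_delete := by
    rintro (e | i)
    · obtain ⟨s, hs, hse⟩ := h.reach_delete e
      obtain ⟨t, ht, hst⟩ := deletionStates_step s hs
      exact ⟨t, ht, (reach_addUnit_of_or hse hst).congr (by rintro (e | i) <;> simp)⟩
    · obtain ⟨s, hs, t, ht, hst⟩ := hST.2 i
      exact ⟨t, ht, (reach_addUnit_of_or (h.reach s hs) hst).congr
        (by rintro (e | i) <;> simp)⟩

/-! ### Closing a pole -/

/-- Attach a triangle to the half-edges of a pole: its first two vertices receive one half-edge
each, its third vertex the other four. -/
def Pole.close {V E : Type} (P : Pole V E) : Net (V ⊕ Fin 3) (E ⊕ Fin 9) where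
  src := Sum.elim (fun e ↦ .inl (P.src e))
    ![.inl (P.term 0), .inl (P.term 1), .inl (P.term 2), .inl (P.term 3), .inl (P.term 4),
      .inl (P.term 5), .inr 0, .inr 0, .inr 1]
  tgt := Sum.elim (fun e ↦ .inl (P.tgt e))
    ![.inr 1, .inr 0, .inr 2, .inr 2, .inr 2, .inr 2, .inr 1, .inr 2, .inr 2]

section Close

variable {V E R : Type} [Fintype E] [CommRing R]

theorem isFlow_close (P : Pole V E) (f : E → R) (u : Fin 9 → R) :
    P.close.IsFlow (Sum.elim f u) ↔
      P.IsFlow f ![u 0, u 1, u 2, u 3, u 4, u 5] ∧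
      u 6 + u 7 = u 1 ∧ u 8 = u 0 + u 6 ∧ u 2 + u 3 + u 4 + u 5 + u 7 + u 8 = 0 := by
  have key : ∀ g : V ⊕ Fin 3 → R,
      P.close.pairing (Sum.elim f u) g =
      (P.pairing f (fun v ↦ g (.inl v)) +
        ∑ j, ![u 0, u 1, u 2, u 3, u 4, u 5] j * g (.inl (P.term j))) +
      (u 6 + u 7 - u 1) * g (.inr 0) + (u 8 - u 0 - u 6) * g (.inr 1) -
      (u 2 + u 3 + u 4 + u 5 + u 7 + u 8) * g (.inr 2) := by
    intro g
    simp only [Net.pairing, Fintype.sum_sum_type, Fin.sum_univ_six, Fin.sum_univ_succ (n := 8),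
      Fin.sum_univ_eight, Pole.close, Sum.elim_inl, Sum.elim_inr, Matrix.cons_val,
      Matrix.cons_val_succ, Matrix.cons_val_zero, Fin.succ_one_eq_two, Fin.succ_zero_eq_one]
    simp only [Fin.reduceSucc]
    ring
  constructor
  · intro h
    have h' : ∀ g, _ = (0 : R) := fun g ↦ (key g).symm.trans (h g)
    refine ⟨fun g ↦ by simpa using h' (Sum.elim g 0), ?_, ?_, ?_⟩
    · have := h' (Sum.elim 0 (Pi.single 0 1))
      simp [Net.pairing] at this
      linear_combination this
    · have := h' (Sum.elim 0 (Pi.single 1 1))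
      simp [Net.pairing] at this
      linear_combination this
    · have := h' (Sum.elim 0 (Pi.single 2 1))
      simp [Net.pairing] at this
      linear_combination -this
  · rintro ⟨h, h₀, h₁, h₂⟩ g
    rw [key, h]
    linear_combination h₀ * g (.inr 0) + h₁ * g (.inr 1) - h₂ * g (.inr 2)

/-- The values on the closing edges determined by the boundary values `s` and the value `r` on the
edge of the triangle between its second and third vertex. -/
def closeEdges (s : Fin 6 → ℤ) (r : ℤ) : Fin 9 → ℤ :=
  ![s 0, s 1, s 2, s 3, s 4, s 5, r - s 0, s 1 - r + s 0, r]

/-- The boundary values `s` extend over the closing edges, with exactly those in `Y` carrying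
zero. -/
def Closes (Y : Fin 9 → Prop) (s : Fin 6 → ℤ) : Prop :=
  s 0 + s 1 + s 2 + s 3 + s 4 + s 5 = 0 ∧
    ∃ r ∈ ([0, 1, -1, 2, -2] : List ℤ), SmallOff Y (closeEdges s r)

instance (Y : Fin 9 → Prop) [DecidablePred Y] (s : Fin 6 → ℤ) : Decidable (Closes Y s) := by
  unfold Closes SmallOff; infer_instance

theorem Pole.Reach.close {P : Pole V E} {X : E → Prop} {Y : Fin 9 → Prop} {s : Fin 6 → ℤ}
    (h : P.Reach X s) (hs : Closes Y s) :
    ∃ f, SmallOff (Sum.elim X Y) f ∧ P.close.IsFlow f := by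
  obtain ⟨f, hf, hflow⟩ := h
  obtain ⟨h₀, r, -, hu⟩ := hs
  refine ⟨Sum.elim f (closeEdges s r), hf.sumElim hu, ?_⟩
  rw [isFlow_close]
  refine ⟨?_, ?_, ?_, ?_⟩
  · convert hflow
    ext j
    fin_cases j <;> simp [closeEdges]
  all_goals
    simp only [closeEdges, Matrix.cons_val]
    linarith

end Close

theorem deletionStates_closes : ∀ s ∈ deletionStates, Closes (fun _ ↦ False) s := by
  decide

/-- Modulo `3`, the first two vertices of the closing triangle have degree three and receive equal
values from a good pole, so nothing is left for one of their edges. -/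
theorem Pole.Good.isCritical_close {V E : Type} [Fintype E] {S : List (Fin 6 → ℤ)} {P : Pole V E}
    (h : P.Good S) (hS : ∀ i, ∃ s ∈ S, Closes (· = i) s) : P.close.IsCritical where
  loopless := by
    rintro (e | i)
    · simpa [Pole.close] using h.loopless e
    · fin_cases i <;> simp [Pole.close]
  connected := by
    intro p hp
    have hP : ∀ x y, p (.inl x) → p (.inl y) :=
      h.connected (fun v ↦ p (.inl v)) fun e ↦ hp (.inl e)
    have key : ∀ x, p x ↔ p (.inl (P.term 0)) := by
      have h₀ : p (.inl (P.term 0)) ↔ p (.inr 1) := hp (.inr 0)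
      have h₁ : p (.inl (P.term 1)) ↔ p (.inr 0) := hp (.inr 1)
      have h₂ : p (.inl (P.term 2)) ↔ p (.inr 2) := hp (.inr 2)
      rintro (x | i)
      · exact ⟨hP _ _, hP _ _⟩
      · fin_cases i
        exacts [h₁.symm.trans ⟨hP _ _, hP _ _⟩, h₀.symm, h₂.symm.trans ⟨hP _ _, hP _ _⟩]
    exact fun x y hx ↦ (key y).2 ((key x).1 hx)
  no_flow := by
    intro f hf hflow
    have hf' : f = Sum.elim (fun e ↦ f (.inl e)) fun i ↦ f (.inr i) := by
      ext (e | i) <;> rfl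
    rw [hf', isFlow_close] at hflow
    obtain ⟨hP, h₀, h₁, -⟩ := hflow
    have hu : ∀ i, f (.inr i) ≠ 0 := fun i ↦ hf _
    have heq := h.parity _ _ (fun e ↦ hf _) (fun j ↦ by
      fin_cases j
      exacts [hu 0, hu 1, hu 2, hu 3, hu 4, hu 5]) hP
    simp only [Matrix.cons_val] at heq
    have cubic : ∀ x y z : ZMod 3, x ≠ 0 → y ≠ 0 → z ≠ 0 → x + y = z → x = -z := by decide
    refine hu 8 ?_
    rw [h₁, cubic _ _ _ (hu 6) (hu 7) (hu 1) h₀, heq, add_neg_cancel]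
  delete_flow := by
    rintro (e | i)
    · obtain ⟨s, hs, hse⟩ := h.reach_delete e
      obtain ⟨f, hf, hflow⟩ := hse.close (deletionStates_closes s hs)
      exact ⟨f, hf.congr (by rintro (e | i) <;> simp), hflow⟩
    · obtain ⟨s, hs, hst⟩ := hS i
      obtain ⟨f, hf, hflow⟩ := (h.reach s hs).close hst
      exact ⟨f, hf.congr (by rintro (e | i) <;> simp), hflow⟩

/-! ### The chain of units -/

/-- Boundary values without zeros that are available from every pole of the chain. -/
def fullStates : List (Fin 6 → ℤ) :=
  [![1, 1, -1, -2, -1, 2], ![1, 1, -1, -1, -1, 1], ![2, -1, 2, -1, -1, -1]]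

/-- Boundary values of the initial pole. -/
def initialStates : List (Fin 6 → ℤ) := fullStates ++
  [![0, -2, 1, 1, -1, 1], ![-2, 0, 1, 1, -1, 1], ![-2, 1, 0, 1, -1, 1], ![-2, 1, 1, 0, -1, 1],
    ![-2, 1, 1, 1, 0, -1], ![-2, 1, 1, 1, -1, 0]]

/-- Boundary values of the chain with one unit. -/
def secondStates : List (Fin 6 → ℤ) := fullStates ++
  [![0, -1, -1, 2, -1, 1], ![-1, 0, -1, 2, -1, 1], ![-1, -1, 0, 2, 1, -1], ![-2, 1, 1, 0, -2, 2],
    ![-2, 1, 1, 1, 0, -1], ![-1, 1, -2, 1, 1, 0]]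

/-- Boundary values of every chain with at least two units. -/
def stableStates : List (Fin 6 → ℤ) := fullStates ++
  [![0, 1, -2, 1, -1, 1], ![-1, 0, -1, 2, -1, 1], ![-1, -1, 0, 2, 1, -1], ![-1, 1, 0, -2, 1, 1],
    ![-2, 1, 1, 0, -2, 2], ![-1, 1, -2, 0, 1, 1], ![-2, 1, 1, 1, 0, -1], ![-1, 1, -2, 1, 0, 1],
    ![-1, 1, -2, 1, 1, 0]]

theorem advances_initial : Advances initialStates secondStates := by decide

theorem advances_second : Advances secondStates stableStates := by decide

theorem advances_stable : Advances stableStates stableStates := by decide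

theorem stableStates_closes : ∀ i, ∃ s ∈ stableStates, Closes (· = i) s := by decide

/-- Two adjacent vertices, one with two half-edges and one with four. -/
def initialPole : Pole (Fin 2) Unit where
  src _ := 0
  tgt _ := 1
  term := ![0, 0, 1, 1, 1, 1]

theorem isFlow_initialPole {f : ℤ} {b : Fin 6 → ℤ} (h : f = -(b 0 + b 1))
    (h' : b 2 + b 3 + b 4 + b 5 = f) : initialPole.IsFlow (fun _ ↦ f) b := by
  intro g
  simp only [Net.pairing, initialPole, Fin.sum_univ_six, Matrix.cons_val, Finset.univ_unique,
    Finset.sum_const, Finset.card_singleton, one_smul]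
  linear_combination g 0 * h + g 1 * h'

theorem initialPole_good : initialPole.Good initialStates where
  loopless := by simp [initialPole]
  connected p hp := by
    have h : p 0 ↔ p 1 := hp ()
    intro x y hx
    fin_cases x <;> fin_cases y <;> simp_all
  parity := by
    intro f b hf hb h
    have key : ∀ a x y : ZMod 3, a ≠ 0 → x ≠ 0 → y ≠ 0 → a + (x + y) = 0 → x = y := by decide
    have h₀ := h (Pi.single 0 1)
    simp [Net.pairing, initialPole, Fin.sum_univ_six] at h₀
    exact key _ _ _ (hf ()) (hb 0) (hb 1) h₀
  reach s hs := by
    have h : ∀ s ∈ initialStates, IsSmall (-(s 0 + s 1)) ∧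
        s 2 + s 3 + s 4 + s 5 = -(s 0 + s 1) := by decide
    exact ⟨_, fun _ ↦ ⟨False.elim, fun _ ↦ (h s hs).1⟩, isFlow_initialPole rfl (h s hs).2⟩
  reach_delete e := by
    refine ⟨![1, -1, 1, -1, -1, 1], by decide, fun _ ↦ 0,
      fun _ ↦ ⟨fun _ ↦ rfl, fun h ↦ absurd rfl h⟩, isFlow_initialPole ?_ ?_⟩ <;> simp

theorem exists_good_pole (k : ℕ) : ∃ (V E : Type) (_ : Fintype V) (_ : Fintype E) (P : Pole V E),
    Fintype.card V = 4 * k + 10 ∧ Fintype.card E = 7 * k + 15 ∧ P.Good stableStates := by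
  induction k with
  | zero =>
    exact ⟨_, _, inferInstance, inferInstance, initialPole.addUnit.addUnit, by simp, by simp,
      (initialPole_good.addUnit advances_initial).addUnit advances_second⟩
  | succ k ih =>
    obtain ⟨V, E, _, _, P, hV, hE, hP⟩ := ih
    refine ⟨_, _, inferInstance, inferInstance, P.addUnit, ?_, ?_, hP.addUnit advances_stable⟩
    · simp [hV]; ring
    · simp [hE]; ring

theorem realizable_chain (k : ℕ) : Realizable (4 * k + 11) (7 * k + 23) := by
  obtain ⟨V, E, _, _, P, hV, hE, hP⟩ := exists_good_pole k
  exact ⟨_, _, inferInstance, inferInstance, P.close, by simp [hV], by simp [hE],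
    hP.isCritical_close stableStates_closes⟩

/-! ### Densities -/

/-- A single edge is neutral for gluing. -/
theorem realizable_zero : Realizable 0 0 := by
  refine ⟨Fin 2, Unit, inferInstance, inferInstance, ⟨fun _ ↦ 0, fun _ ↦ 1⟩, rfl, rfl,
    by simp, fun p hp x y hx ↦ ?_, fun f hf h ↦ ?_, fun e ↦ ⟨0, ?_, fun g ↦ by simp [Net.pairing]⟩⟩
  · have h : p 0 ↔ p 1 := hp ()
    fin_cases x <;> fin_cases y <;> simp_all
  · have h₀ := h (Pi.single 0 1)
    simp [Net.pairing] at h₀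
    exact hf () h₀
  · exact fun _ ↦ ⟨fun _ ↦ rfl, fun h ↦ absurd rfl h⟩

theorem Realizable.mul {a b : ℕ} (h : Realizable a b) (k : ℕ) : Realizable (k * a) (k * b) := by
  induction k with
  | zero => simpa using realizable_zero
  | succ k ih =>
    rw [add_mul, add_mul, one_mul, one_mul]
    exact ih.add h

/-- A block with parameters `(4, 9)` can be exchanged for two blocks with parameters `(2, 5)`, which
changes the number of edges by one and keeps the number of vertices. -/
theorem realizable_exchange (c d : ℕ) : Realizable (4 * (c + d)) (9 * (c + d) + c) := by
  have h := (realizable_k4.mul (2 * c)).add ((realizable_bipartite 0).mul d)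
  convert h using 1 <;> ring

/-- Mixing blocks of densities on either side of `r`, and correcting by exchanges, every density
is attained up to rounding the number of edges. -/
theorem exists_realizable (N : ℕ) (r : ℚ) (hr : 7 / 4 < r) (hr' : r < 3) :
    ∃ a b : ℕ, N ≤ a ∧ Realizable a b ∧ |((b + 1 : ℕ) : ℚ) - r * ((a + 2 : ℕ) : ℚ)| ≤ 1 / 2 := by
  obtain ⟨s, hs⟩ := exists_nat_gt ((4 * r - 9) / (6 - 2 * r))
  obtain ⟨k, hk⟩ := exists_nat_gt ((23 - 11 * r) / (4 * r - 7))
  rw [div_lt_iff₀ (by linarith)] at hs hk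
  obtain ⟨a₁, b₁, ha₁, h₁, hd₁⟩ : ∃ a b : ℕ, 0 < a ∧ Realizable a b ∧ r * a < b :=
    ⟨_, _, by omega, realizable_bipartite s, by push_cast; linarith⟩
  obtain ⟨a₂, b₂, ha₂, h₂, hd₂⟩ : ∃ a b : ℕ, 0 < a ∧ Realizable a b ∧ (b : ℚ) < r * a :=
    ⟨_, _, by omega, realizable_chain k, by push_cast; linarith⟩
  have ha₁' : (0 : ℚ) < a₁ := by exact_mod_cast ha₁
  have ha₂' : (0 : ℚ) < a₂ := by exact_mod_cast ha₂
  set ε₁ : ℚ := a₁ * (r * a₂ - b₂)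
  set ε₂ : ℚ := a₂ * (b₁ - r * a₁)
  have hε₁ : 0 < ε₁ := mul_pos ha₁' (by linarith)
  have hε₂ : 0 < ε₂ := mul_pos ha₂' (by linarith)
  -- Replacing `a₁` blocks of the sparse kind by `a₂` of the dense kind adds `D` edges.
  obtain ⟨D, hD⟩ : ∃ D, a₂ * b₁ = a₁ * b₂ + D := by
    refine Nat.exists_eq_add_of_le (le_of_lt ?_)
    have : (a₁ : ℚ) * b₂ < a₂ * b₁ := by
      have : ε₁ + ε₂ = a₂ * b₁ - a₁ * b₂ := by ring
      linarith
    exact_mod_cast this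
  have hD' : (D : ℚ) = ε₁ + ε₂ := by
    have : (a₂ : ℚ) * b₁ = a₁ * b₂ + D := by exact_mod_cast hD
    linear_combination -this
  have hD₀ : 0 < D := by
    have : (0 : ℚ) < D := by linarith
    exact_mod_cast this
  let K : ℚ := r * (4 * D + 2) - 1 - 9 * D
  obtain ⟨M₁, hM₁⟩ := exists_nat_ge (-K / ε₁)
  obtain ⟨M₂, hM₂⟩ := exists_nat_ge ((K + 1 / 2) / ε₂)
  rw [div_le_iff₀ (by assumption)] at hM₁ hM₂
  let M := M₁ + M₂ + N
  have hMK₁ : -K ≤ M * ε₁ := hM₁.trans (by gcongr; omega)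
  have hMK₂ : K + 1 / 2 ≤ M * ε₂ := hM₂.trans (by gcongr; omega)
  -- The number of edges to be added to `M * a₁` sparse blocks and `D` blocks `(4, 9)`.
  let T := ⌊M * ε₁ + K + 1 / 2⌋₊
  have hT : (T : ℚ) ≤ M * ε₁ + K + 1 / 2 := Nat.floor_le (by linarith)
  have hT' : M * ε₁ + K + 1 / 2 < T + 1 := Nat.lt_floor_add_one _
  have hTM : T ≤ D * M := by
    have : (T : ℚ) ≤ D * M := by rw [hD']; linarith
    exact_mod_cast this
  obtain ⟨j, hj⟩ : ∃ j, M = T / D + j :=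
    Nat.exists_eq_add_of_le (Nat.div_le_of_le_mul hTM)
  obtain ⟨d, hd⟩ : ∃ d, D = T % D + d := Nat.exists_eq_add_of_le (Nat.mod_lt T hD₀).le
  have hTD : D * (T / D) + T % D = T := Nat.div_add_mod T D
  refine ⟨a₁ * a₂ * M + 4 * D, a₁ * b₂ * M + 9 * D + T, ?_, ?_, ?_⟩
  · have : 1 * N ≤ a₁ * a₂ * M := Nat.mul_le_mul (Nat.mul_pos ha₁ ha₂) (by omega)
    omega
  · have h := ((h₁.mul (T / D * a₂)).add (h₂.mul (j * a₁))).add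
      (realizable_exchange (T % D) d)
    rw [← hd] at h
    convert h using 1
    · rw [hj]; ring
    · rw [hj]
      generalize T / D = q at *
      generalize T % D = c at *
      have hq : q * a₂ * b₁ = q * (a₁ * b₂) + D * q := by rw [mul_assoc, hD]; ring
      rw [hq]
      linarith
  · have hM : (M : ℚ) * ε₁ + K = r * (a₁ * a₂ * M + 4 * D + 2) - (a₁ * b₂ * M + 9 * D + 1) := by
      simp only [K, ε₁]; ring
    rw [abs_le]
    push_cast
    constructor <;> linarith

end FlowNet

theorem mainTheorem9 (N : ℕ) (hN : 0 < N) (r : ℚ) (hr : 7 / 4 < r) (hr' : r < 3) :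
    ∃ (α β : Type) (G : Graph α β),
      V(G).Finite ∧ E(G).Finite ∧ G.Loopless ∧ G.IsConnected ∧
      G.IsThreeFlowCritical ∧
      N ≤ V(G).ncard ∧
      r * (V(G).ncard : ℚ) - 5 / 8 ≤ (E(G).ncard : ℚ) ∧
      (E(G).ncard : ℚ) ≤ r * (V(G).ncard : ℚ) + 5 / 8 := by
  obtain ⟨a, b, hN', ⟨V, E, _, _, G, hV, hE, hG⟩, hab⟩ :=
    FlowNet.exists_realizable (N + 1) r hr hr'
  rw [abs_le] at hab
  have hVc : V(G.toGraph).ncard = a + 2 := by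
    rw [← hV, ← Nat.card_eq_fintype_card]
    exact Set.ncard_univ V
  have hEc : E(G.toGraph).ncard = b + 1 := by
    rw [← hE, ← Nat.card_eq_fintype_card]
    exact Set.ncard_univ E
  have : Nonempty V := Fintype.card_pos_iff.1 (by omega)
  have hE' : 1 < Fintype.card E := by
    have h : (1 : ℚ) < (b + 1 : ℕ) := by
      have : (2 : ℚ) ≤ (a + 2 : ℕ) := by norm_cast; omega
      nlinarith
    rw [hE]
    exact_mod_cast h
  refine ⟨V, E, G.toGraph, Set.toFinite _, Set.toFinite _, G.toGraph_loopless hG.loopless,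
    G.toGraph_isConnected hG.connected, hG.isThreeFlowCritical hE', ?_, ?_, ?_⟩
  · omega
  · rw [hVc, hEc]; linarith
  · rw [hVc, hEc]; linarith
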